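/- Let $k,p,q\in\mathbb N_0$ with $q<p$ and let $(\mathbf A^*,\mathbf B^*,\mathbf C^*,L)$ be a state space model of dimension $kp$: $\mathbf A^*\in M_{kp}(\mathbb R)$, $\mathbf B^*\in M_{kp\times k}(\mathbb R)$, $\mathbf C^*\in M_{k\times kp}(\mathbb R)$, and $L=(L(t))_{t\in\mathbb R}$ is an $\mathbb R^k$-valued Lévy process (stationary and independent increments, continuous in probability, $L(0)=0$ a.s.). Let $$H(z)=\mathbf C^*(zI_{kp}-\mathbf A^*)^{-1}\mathbf B^*,\qquad z\in\mathbb C\setminus\sigma(\mathbf A^*),$$ be its transfer function, where $\sigma(\cdot)$ denotes the set of complex eigenvalues. Consider real $(k\times k)$-matrix polynomials of the form $$P(z)=I_kz^p+A_1z^{p-1}+\dots+A_p,\qquad Q(z)=C_0+C_1z+\dots+C_qz^q. \tag{1}$$ Suppose that they form a coprime right polynomial fraction description of $H$, that is, the $(2k\times k)$-matrix $[P(z)^\top\ Q(z)^\top]^\top$ has full rank $k$ for every $z\in\mathbb C$, and for every $z\in\mathbb C\setminus\sigma(\mathbf A^*)$ the matrix $P(z)$ is invertible and $H(z)=Q(z)P(z)^{-1}$.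 Then: 1. $P$ and $Q$ are unique: if $P_1,Q_1$ are also of the form (1), for some degrees $q_1<p_1$, and form a coprime right polynomial fraction description of $H$, then $P_1=P$ and $Q_1=Q$. 2. Define, with $(k\times k)$-blocks, $$\mathbf A=\begin{pmatrix}0&I_k&&\\&\ddots&\ddots&\\&&0&I_k\\-A_p&-A_{p-1}&\cdots&-A_1\end{pmatrix}\in M_{kp}(\mathbb R),\quad \mathbf B=\begin{pmatrix}0\\\vdots\\0\\I_k\end{pmatrix}\in M_{kp\times k}(\mathbb R),\quad \mathbf C=\begin{pmatrix}C_0&\cdots&C_q&0&\cdots&0\end{pmatrix}\in M_{k\times kp}(\mathbb R).$$ Then $\sigma(\mathbf A^*)=\sigma(\mathbf A)$ and $H(z)=\mathbf C(zI_{kp}-\mathbf A)^{-1}\mathbf B$ for all $z\in\mathbb C\setminus\sigma(\mathbf A)$. 3. A process $\mathcal Y=(Y(t))_{t\in\mathbb R}$ is a solution of the state space model $(\mathbf A^*,\mathbf B^*,\mathbf C^*,L)$ if and only if it is a solution of $(\mathbf A,\mathbf B,\mathbf C,L)$. Here $\mathcal Y$ is a solution of $(\mathbf A,\mathbf B,\mathbf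 C,L)$ if $Y(t)=\mathbf CX(t)$ a.s. for all $t$, for some $\mathbb R^{kp}$-valued process $X$ with $dX(t)=\mathbf AX(t)\,dt+\mathbf B\,dL(t)$. The equivalence holds both when the state equation is read as the integral equation $X(t)-X(s)=\int_s^t\mathbf AX(u)\,du+\mathbf B(L(t)-L(s))$ a.s. for all $s<t$ (with $X$ a.s. integrable on $[s,t]$), and when it is read as the solution formula $X(t)=e^{\mathbf A(t-s)}X(s)+\int_s^te^{\mathbf A(t-u)}\mathbf B\,dL(u)$ a.s. for all $s<t$, where the stochastic integral is the limit in probability of Riemann–Stieltjes sums. -/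

import Mathlib

open MeasureTheory ProbabilityTheory Filter Topology Polynomial

namespace StateSpace

noncomputable section

/-! ### Matrix polynomials and transfer functions -/

/-- A real matrix regarded as a complex matrix. -/
abbrev toC {m n : Type*} (M : Matrix m n ℝ) : Matrix m n ℂ := M.map (fun x : ℝ => (x : ℂ))

/-- The set `σ(A) ⊆ ℂ` of complex eigenvalues of a real square matrix. -/
def eigenvalues {n : Type*} [Fintype n] [DecidableEq n] (A : Matrix n n ℝ) : Set ℂ :=
  spectrum ℂ (toC A)

/-- The transfer function `H(z) = C (z I - A)⁻¹ B`; it is meaningful for `z ∉ σ(A)`. -/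
def transfer {n : Type*} [Fintype n] [DecidableEq n] {k : ℕ} (A : Matrix n n ℝ)
    (B : Matrix n (Fin k) ℝ) (C : Matrix (Fin k) n ℝ) (z : ℂ) : Matrix (Fin k) (Fin k) ℂ :=
  toC C * (z • (1 : Matrix n n ℂ) - toC A)⁻¹ * toC B

/-- The value `P(z) = ∑ i, z ^ i • P_i` at `z ∈ ℂ` of a real matrix polynomial. -/
def evalAt {k : ℕ} (P : (Matrix (Fin k) (Fin k) ℝ)[X]) (z : ℂ) : Matrix (Fin k) (Fin k) ℂ :=
  P.sum fun i M => z ^ i • toC M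

/-- `P(z) = I z ^ p + A_1 z ^ (p - 1) + ⋯ + A_p` and `Q(z) = C_0 + C_1 z + ⋯ + C_q z ^ q`
with `q < p`; thus `A_j = P.coeff (p - j)` and `C_j = Q.coeff j`. -/
structure IsMonicPair {k : ℕ} (p q : ℕ) (P Q : (Matrix (Fin k) (Fin k) ℝ)[X]) : Prop where
  lt : q < p
  coeff_lead : P.coeff p = 1
  coeff_above : ∀ i, p < i → P.coeff i = 0
  coeff_num : ∀ i, q < i → Q.coeff i = 0

/-- `P` and `Q` are right coprime: the `2k × k` matrix with `P(z)` on top of `Q(z)` has full rank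
for every `z ∈ ℂ`. -/
def RightCoprime {k : ℕ} (P Q : (Matrix (Fin k) (Fin k) ℝ)[X]) : Prop :=
  ∀ z : ℂ, (Matrix.fromRows (evalAt P z) (evalAt Q z)).rank = k

/-- `(P, Q)` is a coprime right polynomial fraction description of the transfer function of
`(A, B, C)`: it is right coprime and `H(z) = Q(z) P(z)⁻¹` (with `P(z)` invertible)
for all `z ∈ ℂ \ σ(A)`. -/
def IsCoprimeRightFraction {n : Type*} [Fintype n] [DecidableEq n] {k : ℕ} (A : Matrix n n ℝ)
    (B : Matrix n (Fin k) ℝ) (C : Matrix (Fin k) n ℝ)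
    (P Q : (Matrix (Fin k) (Fin k) ℝ)[X]) : Prop :=
  RightCoprime P Q ∧
    ∀ z : ℂ, z ∉ eigenvalues A →
      IsUnit (evalAt P z) ∧ transfer A B C z = evalAt Q z * (evalAt P z)⁻¹

/-! ### The controller canonical triple

The `kp` coordinates are indexed by pairs (block, position inside the block), in lexicographic
order; blocks are numbered from `0`. -/

/-- Identity blocks on the block superdiagonal, last block row `(-A_p, -A_{p-1}, …, -A_1)`. -/
def canonicalA {k : ℕ} (p : ℕ) (P : (Matrix (Fin k) (Fin k) ℝ)[X]) :
    Matrix (Fin p × Fin k) (Fin p × Fin k) ℝ :=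
  Matrix.of fun r s =>
    if (r.1 : ℕ) + 1 = p then -(P.coeff (s.1 : ℕ) r.2 s.2)
    else if (s.1 : ℕ) = (r.1 : ℕ) + 1 then (1 : Matrix (Fin k) (Fin k) ℝ) r.2 s.2 else 0

/-- The block column `(0, …, 0, I)`. -/
def canonicalB (k p : ℕ) : Matrix (Fin p × Fin k) (Fin k) ℝ :=
  Matrix.of fun r b => if (r.1 : ℕ) + 1 = p then (1 : Matrix (Fin k) (Fin k) ℝ) r.2 b else 0

/-- The block row `(C_0, C_1, …, C_q, 0, …, 0)`. -/
def canonicalC {k : ℕ} (p : ℕ) (Q : (Matrix (Fin k) (Fin k) ℝ)[X]) :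
    Matrix (Fin k) (Fin p × Fin k) ℝ :=
  Matrix.of fun a s => Q.coeff (s.1 : ℕ) a s.2

/-! ### Lévy processes and solutions of state space models -/

variable {Ω : Type*} [MeasurableSpace Ω]

/-- A two-sided `ℝ^k`-valued Lévy process: independent and stationary increments, continuous in
probability, and `L(0) = 0` almost surely. -/
structure IsLevyProcess (μ : Measure Ω) {k : ℕ} (L : ℝ → Ω → Fin k → ℝ) : Prop where
  measurable : ∀ t, Measurable (L t)
  indep_increments : HasIndepIncrements L μ
  stationary_increments : ∀ s t h : ℝ,
    IdentDistrib (fun ω => L (t + h) ω - L (s + h) ω) (fun ω => L t ω - L s ω) μ μ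
  continuous_in_probability : ∀ t, TendstoInMeasure μ L (𝓝 t) (L t)
  zero : ∀ᵐ ω ∂μ, L 0 ω = 0

/-- `Z` is (a version of) the stochastic integral `∫_s^t f(u) dL(u)` of a continuous deterministic
matrix-valued function `f`: the limit in probability of the Riemann–Stieltjes sums
`∑ f(u_i) (L(u_{i+1}) - L(u_i))` along all sequences of partitions
`s = u_0 ≤ u_1 ≤ ⋯ ≤ u_N = t` whose mesh tends to `0`. -/
def IsStochasticIntegral (μ : Measure Ω) {k : ℕ} (L : ℝ → Ω → Fin k → ℝ) {n : Type*} [Fintype n]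
    (f : ℝ → Matrix n (Fin k) ℝ) (s t : ℝ) (Z : Ω → n → ℝ) : Prop :=
  ∀ (N : ℕ → ℕ) (u : ℕ → ℕ → ℝ),
    (∀ m, Monotone (u m)) → (∀ m, u m 0 = s) → (∀ m, u m (N m) = t) →
    (∀ δ : ℝ, 0 < δ → ∀ᶠ m in atTop, ∀ i < N m, u m (i + 1) - u m i < δ) →
    TendstoInMeasure μ
      (fun m ω => ∑ i ∈ Finset.range (N m),
        Matrix.mulVec (f (u m i)) (L (u m (i + 1)) ω - L (u m i) ω)) atTop Z

variable {n : Type*} [Fintype n]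

/-- `X` solves `dX(t) = A X(t) dt + B dL(t)`, in integral form:
`X(t) - X(s) = ∫_s^t A X(u) du + B (L(t) - L(s))` almost surely, for all `s < t`. -/
def SolvesStateEquation (μ : Measure Ω) {k : ℕ} (L : ℝ → Ω → Fin k → ℝ) (A : Matrix n n ℝ)
    (B : Matrix n (Fin k) ℝ) (X : ℝ → Ω → n → ℝ) : Prop :=
  (∀ t, Measurable (X t)) ∧
    ∀ s t : ℝ, s < t → ∀ᵐ ω ∂μ,
      IntervalIntegrable (fun u => X u ω) volume s t ∧
        X t ω - X s ω =
          (∫ u in s..t, Matrix.mulVec A (X u ω)) + Matrix.mulVec B (L t ω - L s ω)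

/-- `X` satisfies `X(t) = e^{A (t - s)} X(s) + ∫_s^t e^{A (t - u)} B dL(u)` for all `s < t`. -/
def SatisfiesSolutionFormula [DecidableEq n] (μ : Measure Ω) {k : ℕ} (L : ℝ → Ω → Fin k → ℝ)
    (A : Matrix n n ℝ) (B : Matrix n (Fin k) ℝ) (X : ℝ → Ω → n → ℝ) : Prop :=
  (∀ t, Measurable (X t)) ∧
    ∀ s t : ℝ, s < t →
      IsStochasticIntegral μ L (fun u => NormedSpace.exp ((t - u) • A) * B) s t
        (fun ω => X t ω - Matrix.mulVec (NormedSpace.exp ((t - s) • A)) (X s ω))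

/-- `Y` is a solution (output process) of the state space model `(A, B, C, L)`:
`Y(t) = C X(t)` for an input process `X` that solves the state equation. -/
def IsSolution (μ : Measure Ω) {k : ℕ} (L : ℝ → Ω → Fin k → ℝ) (A : Matrix n n ℝ)
    (B : Matrix n (Fin k) ℝ) (C : Matrix (Fin k) n ℝ) (Y : ℝ → Ω → Fin k → ℝ) : Prop :=
  ∃ X : ℝ → Ω → n → ℝ, SolvesStateEquation μ L A B X ∧
    ∀ t, ∀ᵐ ω ∂μ, Y t ω = Matrix.mulVec C (X t ω)

/-- `Y` is a solution of `(A, B, C, L)` in the variation-of-constants sense: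
`Y(t) = C X(t)` for an input process `X` given by the solution formula. -/
def IsMildSolution [DecidableEq n] (μ : Measure Ω) {k : ℕ} (L : ℝ → Ω → Fin k → ℝ)
    (A : Matrix n n ℝ) (B : Matrix n (Fin k) ℝ) (C : Matrix (Fin k) n ℝ)
    (Y : ℝ → Ω → Fin k → ℝ) : Prop :=
  ∃ X : ℝ → Ω → n → ℝ, SatisfiesSolutionFormula μ L A B X ∧
    ∀ t, ∀ᵐ ω ∂μ, Y t ω = Matrix.mulVec C (X t ω)

end

end StateSpace

/-! The canonical triple built from `P` and `Q` is a realization of `Q(z) P(z)⁻¹`, because its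
resolvent acts explicitly on the block column of powers of `z` (`canonicalA_mul_powerColumn`). It is
always controllable, and right coprimeness makes it observable by an eigenvector argument
(`isObservable_canonical`). Its transfer function agrees with `H` near infinity, so the two triples
have the same Markov parameters `C A ^ i B` (`markov_eq_of_transfer_eq`). Since both have dimension
`kp`, the state space isomorphism theorem (`exists_similarity`) gives an invertible `T` carrying one
triple to the other. Spectrum and transfer function are invariant under `T`, and both readings of
the state equation are linear, so `X ↦ T X` transports solutions.

For uniqueness, two coprime fractions give two minimal realizations of the same Markov parameters.
Their dimensions agree, and they are similar. A similarity between controller canonical triples must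
be the identity (`canonical_similarity_eq_one`), so the coefficients coincide. -/

namespace StateSpace

/-- A state space transformation `T` with inverse `S` carrying `(A', B', C')` to `(A, B, C)`. -/
structure IsSimilarity {n m : Type*} [Fintype n] [DecidableEq n] [Fintype m] [DecidableEq m]
    {k : ℕ} (A' : Matrix m m ℝ) (B' : Matrix m (Fin k) ℝ) (C' : Matrix (Fin k) m ℝ)
    (A : Matrix n n ℝ) (B : Matrix n (Fin k) ℝ) (C : Matrix (Fin k) n ℝ)
    (T : Matrix n m ℝ) (S : Matrix m n ℝ) : Prop where
  mul_inv : T * S = 1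
  inv_mul : S * T = 1
  map_A : T * A' = A * T
  map_B : T * B' = B
  map_C : C * T = C'

/-- The only row vector annihilating all `A ^ i * B` is zero. -/
def IsControllable {n : Type*} [Fintype n] [DecidableEq n] {k : ℕ}
    (A : Matrix n n ℝ) (B : Matrix n (Fin k) ℝ) : Prop :=
  ∀ v : n → ℝ, (∀ i : ℕ, Matrix.vecMul v (A ^ i * B) = 0) → v = 0

/-- The only vector annihilated by all `C * A ^ i` is zero. -/
def IsObservable {n : Type*} [Fintype n] [DecidableEq n] {k : ℕ}
    (A : Matrix n n ℝ) (C : Matrix (Fin k) n ℝ) : Prop :=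
  ∀ v : n → ℝ, (∀ i : ℕ, Matrix.mulVec (C * A ^ i) v = 0) → v = 0

/-! ### Minimal realizations and the state space isomorphism theorem -/

section Realization

variable {n m : Type*} [Fintype n] [DecidableEq n] [Fintype m] [DecidableEq m] {k : ℕ}
  {A' : Matrix m m ℝ} {B' : Matrix m (Fin k) ℝ} {C' : Matrix (Fin k) m ℝ}
  {A : Matrix n n ℝ} {B : Matrix n (Fin k) ℝ} {C : Matrix (Fin k) n ℝ}

theorem IsControllable.ext (h : IsControllable A B) {l : Type*} {M N : Matrix l n ℝ}
    (hMN : ∀ i : ℕ, M * (A ^ i * B) = N * (A ^ i * B)) : M = N := by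
  funext r
  refine sub_eq_zero.1 (h (M r - N r) fun i => ?_)
  rw [Matrix.sub_vecMul, sub_eq_zero]
  exact congrFun (hMN i) r

/-- Observability makes `v ↦ (C A ^ j v)_j` injective. Composing a left inverse of it with the
analogous map of the primed triple gives `T`. -/
theorem IsObservable.exists_intertwiner (h : IsObservable A C)
    (hM : ∀ i : ℕ, C' * A' ^ i * B' = C * A ^ i * B) :
    ∃ T : Matrix n m ℝ, ∀ i : ℕ, T * (A' ^ i * B') = A ^ i * B := by
  let O : (n → ℝ) →ₗ[ℝ] (ℕ → Fin k → ℝ) := LinearMap.pi fun i => (C * A ^ i).mulVecLin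
  let O' : (m → ℝ) →ₗ[ℝ] (ℕ → Fin k → ℝ) := LinearMap.pi fun i => (C' * A' ^ i).mulVecLin
  have hO : LinearMap.ker O = ⊥ := by
    rw [LinearMap.ker_eq_bot']
    exact fun v hv => h v fun i => congrFun hv i
  obtain ⟨g, hg⟩ := O.exists_leftInverse_of_injective hO
  refine ⟨LinearMap.toMatrix' (g ∘ₗ O'), fun i => ?_⟩
  apply Matrix.ext_of_mulVec_single
  intro b
  rw [← Matrix.mulVec_mulVec, LinearMap.toMatrix'_mulVec, LinearMap.comp_apply]
  -- Both sides have `j`-th entry given by the Markov parameter of index `j + i`: the block Hankel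
  -- matrices agree.
  have : O' ((A' ^ i * B').mulVec (Pi.single b 1)) = O ((A ^ i * B).mulVec (Pi.single b 1)) := by
    funext j
    simp only [O, O', LinearMap.pi_apply, Matrix.mulVecLin_apply, Matrix.mulVec_mulVec]
    congr 1
    calc C' * A' ^ j * (A' ^ i * B') = C' * A' ^ (j + i) * B' := by
          simp only [pow_add, Matrix.mul_assoc]
      _ = C * A ^ (j + i) * B := hM _
      _ = C * A ^ j * (A ^ i * B) := by simp only [pow_add, Matrix.mul_assoc]
  rw [this]
  exact LinearMap.congr_fun hg _

/-- The range of `T` contains the columns of all `A ^ i * B`, which span the state space.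
Surjectivity of `T` is expressed dually, as injectivity on row vectors. -/
theorem IsControllable.vecMul_injective (h : IsControllable A B) {T : Matrix n m ℝ}
    (hT : ∀ i : ℕ, T * (A' ^ i * B') = A ^ i * B) :
    Function.Injective (Matrix.vecMulLinear T) := by
  rw [← LinearMap.ker_eq_bot, LinearMap.ker_eq_bot']
  intro v hv
  refine h v fun i => ?_
  rw [← hT, ← Matrix.vecMul_vecMul]
  simp only [Matrix.vecMulLinear_apply] at hv
  rw [hv, Matrix.zero_vecMul]

/-- A controllable and observable realization has the least dimension. -/
theorem card_le_of_markov (hc : IsControllable A B) (ho : IsObservable A C)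
    (hM : ∀ i : ℕ, C' * A' ^ i * B' = C * A ^ i * B) : Fintype.card n ≤ Fintype.card m := by
  obtain ⟨T, hT⟩ := ho.exists_intertwiner hM
  simpa using LinearMap.finrank_le_finrank_of_injective (hc.vecMul_injective hT)

/-- Realizations of the same Markov parameters in the same dimension, one of which is controllable
and observable, are similar. -/
theorem exists_similarity (hc : IsControllable A B) (ho : IsObservable A C)
    (hM : ∀ i : ℕ, C' * A' ^ i * B' = C * A ^ i * B) (hcard : Fintype.card m = Fintype.card n) :
    ∃ T S, IsSimilarity A' B' C' A B C T S := by
  obtain ⟨T, hT⟩ := ho.exists_intertwiner hM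
  obtain ⟨S, hTS⟩ : ∃ S : Matrix m n ℝ, T * S = 1 := by
    obtain ⟨g, hg⟩ := (Matrix.vecMulLinear T).exists_leftInverse_of_injective
      (LinearMap.ker_eq_bot.2 (hc.vecMul_injective hT))
    refine ⟨(LinearMap.toMatrix' g).transpose, ?_⟩
    apply Matrix.ext_of_single_vecMul
    intro i
    rw [← Matrix.vecMul_vecMul, Matrix.vecMul_transpose, LinearMap.toMatrix'_mulVec,
      Matrix.vecMul_one]
    exact LinearMap.congr_fun hg _
  have hST : S * T = 1 := (Matrix.mul_eq_one_comm_of_equiv (Fintype.equivOfCardEq hcard.symm)).1 hTS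
  -- Controllability passes through the invertible `T`; it lets the identities for `A` and `C` be
  -- tested on the columns of `A' ^ i * B'` only.
  have hc' : IsControllable A' B' := by
    intro v hv
    have h0 : Matrix.vecMul v S = 0 := by
      refine hc _ fun i => ?_
      rw [← hT, Matrix.vecMul_vecMul, ← Matrix.mul_assoc, hST, Matrix.one_mul, hv]
    rw [← Matrix.vecMul_one v, ← hST, ← Matrix.vecMul_vecMul, h0, Matrix.zero_vecMul]
  refine ⟨T, S, hTS, hST, hc'.ext fun i => ?_, ?_, hc'.ext fun i => ?_⟩
  · calc T * A' * (A' ^ i * B') = T * (A' ^ (i + 1) * B') := by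
          simp only [pow_succ', Matrix.mul_assoc]
      _ = A ^ (i + 1) * B := hT _
      _ = A * (A ^ i * B) := by simp only [pow_succ', Matrix.mul_assoc]
      _ = A * T * (A' ^ i * B') := by rw [Matrix.mul_assoc, hT]
  · simpa using hT 0
  · rw [Matrix.mul_assoc, hT, ← Matrix.mul_assoc, ← Matrix.mul_assoc, hM]

end Realization

/-! ### Invariance of spectrum and transfer function under similarity -/

section Similarity

variable {n m : Type*} [Fintype n] [DecidableEq n] [Fintype m] [DecidableEq m] {k : ℕ}
  {A' : Matrix m m ℝ} {B' : Matrix m (Fin k) ℝ} {C' : Matrix (Fin k) m ℝ}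
  {A : Matrix n n ℝ} {B : Matrix n (Fin k) ℝ} {C : Matrix (Fin k) n ℝ}
  {T : Matrix n m ℝ} {S : Matrix m n ℝ}

theorem IsSimilarity.symm (h : IsSimilarity A' B' C' A B C T S) :
    IsSimilarity A B C A' B' C' S T where
  mul_inv := h.inv_mul
  inv_mul := h.mul_inv
  map_A := by
    calc S * A = S * (A * T) * S := by
          rw [Matrix.mul_assoc S, Matrix.mul_assoc A, h.mul_inv, Matrix.mul_one]
      _ = A' * S := by
          rw [← h.map_A, ← Matrix.mul_assoc, h.inv_mul, Matrix.one_mul]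
  map_B := by rw [← h.map_B, ← Matrix.mul_assoc, h.inv_mul, Matrix.one_mul]
  map_C := by rw [← h.map_C, Matrix.mul_assoc, h.mul_inv, Matrix.mul_one]

theorem toC_mul {a b c : Type*} [Fintype b] (M : Matrix a b ℝ) (N : Matrix b c ℝ) :
    toC (M * N) = toC M * toC N :=
  Matrix.map_mul (f := Complex.ofRealHom)

theorem toC_one {a : Type*} [DecidableEq a] : toC (1 : Matrix a a ℝ) = 1 :=
  Matrix.map_one _ Complex.ofReal_zero Complex.ofReal_one

theorem toC_pow (M : Matrix n n ℝ) (i : ℕ) : toC (M ^ i) = toC M ^ i :=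
  map_pow (Complex.ofRealHom.mapMatrix) M i

theorem toC_injective {a b : Type*} : Function.Injective (toC : Matrix a b ℝ → Matrix a b ℂ) :=
  Matrix.map_injective Complex.ofReal_injective

theorem IsSimilarity.resolvent_comm (h : IsSimilarity A' B' C' A B C T S) (z : ℂ) :
    toC T * (z • (1 : Matrix m m ℂ) - toC A') = (z • (1 : Matrix n n ℂ) - toC A) * toC T := by
  rw [Matrix.mul_sub, Matrix.sub_mul, ← toC_mul, ← toC_mul, h.map_A]
  simp

theorem not_mem_eigenvalues {z : ℂ} :
    z ∉ eigenvalues A ↔ IsUnit (z • (1 : Matrix n n ℂ) - toC A) := by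
  rw [eigenvalues, spectrum.notMem_iff, Algebra.algebraMap_eq_smul_one]

theorem mul_inv_of_not_mem_eigenvalues {z : ℂ} (hz : z ∉ eigenvalues A) :
    (z • (1 : Matrix n n ℂ) - toC A) * (z • (1 : Matrix n n ℂ) - toC A)⁻¹ = 1 :=
  Matrix.mul_nonsing_inv _ ((Matrix.isUnit_iff_isUnit_det _).1 (not_mem_eigenvalues.1 hz))

theorem inv_mul_of_not_mem_eigenvalues {z : ℂ} (hz : z ∉ eigenvalues A) :
    (z • (1 : Matrix n n ℂ) - toC A)⁻¹ * (z • (1 : Matrix n n ℂ) - toC A) = 1 :=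
  Matrix.nonsing_inv_mul _ ((Matrix.isUnit_iff_isUnit_det _).1 (not_mem_eigenvalues.1 hz))

theorem IsSimilarity.resolvent_inverse (h : IsSimilarity A' B' C' A B C T S) {z : ℂ}
    (hz : z ∉ eigenvalues A) :
    (z • (1 : Matrix m m ℂ) - toC A') *
      (toC S * (z • (1 : Matrix n n ℂ) - toC A)⁻¹ * toC T) = 1 := by
  rw [← Matrix.mul_assoc, ← Matrix.mul_assoc, ← h.symm.resolvent_comm,
    Matrix.mul_assoc (toC S), mul_inv_of_not_mem_eigenvalues hz, Matrix.mul_one, ← toC_mul,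
    h.inv_mul, toC_one]

theorem IsSimilarity.eigenvalues_subset (h : IsSimilarity A' B' C' A B C T S) :
    eigenvalues A' ⊆ eigenvalues A := by
  intro z
  contrapose
  intro hz
  exact not_mem_eigenvalues.2
    (IsUnit.of_mul_eq_one _ (h.resolvent_inverse hz))

theorem IsSimilarity.eigenvalues_eq (h : IsSimilarity A' B' C' A B C T S) :
    eigenvalues A' = eigenvalues A :=
  h.eigenvalues_subset.antisymm h.symm.eigenvalues_subset

theorem IsSimilarity.transfer_eq (h : IsSimilarity A' B' C' A B C T S) {z : ℂ}
    (hz : z ∉ eigenvalues A) : transfer A' B' C' z = transfer A B C z := by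
  rw [transfer, transfer, Matrix.inv_eq_right_inv (h.resolvent_inverse hz), ← h.map_B,
    ← h.symm.map_C, toC_mul, toC_mul]
  simp only [Matrix.mul_assoc]

end Similarity

/-! ### Markov parameters from the transfer function at infinity -/

section Markov

variable {n m : Type*} [Fintype n] [DecidableEq n] [Fintype m] [DecidableEq m] {k : ℕ}

theorem finite_eigenvalues (A : Matrix n n ℝ) : (eigenvalues A).Finite :=
  Matrix.finite_spectrum _

open scoped Matrix.Norms.Operator in
theorem tendsto_resolvent_cobounded (A : Matrix n n ℝ) :
    Tendsto (fun z : ℂ => (z • (1 : Matrix n n ℂ) - toC A)⁻¹) (Bornology.cobounded ℂ) (𝓝 0) := by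
  have := spectrum.resolvent_tendsto_cobounded (𝕜 := ℂ) (toC A)
  refine this.congr fun z => ?_
  rw [resolvent, Algebra.algebraMap_eq_smul_one, Matrix.nonsing_inv_eq_ringInverse]

theorem eventually_not_mem_eigenvalues (A : Matrix n n ℝ) :
    ∀ᶠ z in Bornology.cobounded ℂ, z ∉ eigenvalues A :=
  (finite_eigenvalues A).isBounded

/-- Multiplication of a transfer function by `z` shifts the Markov parameters. -/
theorem transfer_mul_left {A : Matrix n n ℝ} {B : Matrix n (Fin k) ℝ} {C : Matrix (Fin k) n ℝ}
    {z : ℂ} (hz : z ∉ eigenvalues A) :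
    z • transfer A B C z = toC (C * B) + transfer A (A * B) C z := by
  have key : z • (z • (1 : Matrix n n ℂ) - toC A)⁻¹ =
      1 + (z • (1 : Matrix n n ℂ) - toC A)⁻¹ * toC A := by
    have := inv_mul_of_not_mem_eigenvalues hz
    rw [Matrix.mul_sub, Matrix.mul_smul, Matrix.mul_one, sub_eq_iff_eq_add] at this
    exact this
  rw [transfer, transfer, ← Matrix.smul_mul, ← Matrix.mul_smul, key, Matrix.mul_add,
    Matrix.add_mul, Matrix.mul_one, toC_mul, toC_mul]
  simp only [Matrix.mul_assoc]

theorem tendsto_transfer_cobounded (A : Matrix n n ℝ) (B : Matrix n (Fin k) ℝ)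
    (C : Matrix (Fin k) n ℝ) :
    Tendsto (transfer A B C) (Bornology.cobounded ℂ) (𝓝 0) := by
  have hcont : Continuous fun M : Matrix n n ℂ => toC C * M * toC B := by fun_prop
  have := (hcont.tendsto 0).comp (tendsto_resolvent_cobounded A)
  rwa [Matrix.mul_zero, Matrix.zero_mul] at this

theorem tendsto_smul_transfer_cobounded (A : Matrix n n ℝ) (B : Matrix n (Fin k) ℝ)
    (C : Matrix (Fin k) n ℝ) :
    Tendsto (fun z => z • transfer A B C z) (Bornology.cobounded ℂ) (𝓝 (toC (C * B))) := by
  have h := (tendsto_transfer_cobounded A (A * B) C).const_add (toC (C * B))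
  rw [add_zero] at h
  refine h.congr' ?_
  filter_upwards [eventually_not_mem_eigenvalues A] with z hz
  rw [transfer_mul_left hz]

/-- The limit of `z H(z)` at infinity is `C B`, and `z H(z) - C B` is the transfer function of `(A,
A B, C)`. Induction with `B` replaced by `A B` recovers every parameter. -/
theorem markov_eq_of_transfer_eq {A' : Matrix m m ℝ} {B' : Matrix m (Fin k) ℝ}
    {C' : Matrix (Fin k) m ℝ} {A : Matrix n n ℝ} {B : Matrix n (Fin k) ℝ}
    {C : Matrix (Fin k) n ℝ}
    (h : ∀ᶠ z in Bornology.cobounded ℂ, transfer A' B' C' z = transfer A B C z) (i : ℕ) :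
    C' * A' ^ i * B' = C * A ^ i * B := by
  have h0 : ∀ {B : Matrix n (Fin k) ℝ} {B' : Matrix m (Fin k) ℝ},
      (∀ᶠ z in Bornology.cobounded ℂ, transfer A' B' C' z = transfer A B C z) →
        C' * B' = C * B := by
    intro B B' h
    refine toC_injective (tendsto_nhds_unique_of_eventuallyEq
      (tendsto_smul_transfer_cobounded A' B' C') (tendsto_smul_transfer_cobounded A B C) ?_)
    filter_upwards [h] with z hz
    rw [hz]
  induction i generalizing B B' with
  | zero => simpa using h0 h
  | succ i ih =>
    have := @ih (A' * B') (A * B) (by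
      filter_upwards [h, eventually_not_mem_eigenvalues A, eventually_not_mem_eigenvalues A']
        with z hz h1 h2
      have e := transfer_mul_left (B := B) (C := C) h1
      rw [← hz, transfer_mul_left h2, h0 h] at e
      exact add_left_cancel e)
    simpa only [pow_succ, Matrix.mul_assoc] using this

end Markov

/-! ### The controller canonical triple: realization, controllability, observability -/

section Canonical

variable {k p q : ℕ} {P Q : (Matrix (Fin k) (Fin k) ℝ)[X]}

theorem evalAt_eq_sum_range {N : ℕ} (hP : ∀ i, N ≤ i → P.coeff i = 0) (z : ℂ) :
    evalAt P z = ∑ j ∈ Finset.range N, z ^ j • toC (P.coeff j) := by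
  refine Polynomial.sum_eq_of_subset _ (fun i => ?_) fun i hi => ?_
  · ext a b
    simp
  · rw [Finset.mem_range]
    by_contra h
    exact Polynomial.mem_support_iff.1 hi (hP i (not_lt.1 h))

theorem IsMonicPair.evalAt_num (h : IsMonicPair p q P Q) (z : ℂ) :
    evalAt Q z = ∑ j : Fin p, z ^ (j : ℕ) • toC (Q.coeff j) := by
  rw [evalAt_eq_sum_range (fun i hi => h.coeff_num i (h.lt.trans_le hi)), Finset.sum_range]

theorem IsMonicPair.evalAt_den (h : IsMonicPair p q P Q) (z : ℂ) :
    evalAt P z = (∑ j : Fin p, z ^ (j : ℕ) • toC (P.coeff j)) + z ^ p • 1 := by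
  rw [evalAt_eq_sum_range (N := p + 1) (fun i hi => h.coeff_above i hi),
    Finset.sum_range_succ, h.coeff_lead, toC_one, Finset.sum_range]

/-- The block column `(I, z I, …, z ^ (p - 1) I)`. -/
def powerColumn (k p : ℕ) (z : ℂ) : Matrix (Fin p × Fin k) (Fin k) ℂ :=
  Matrix.of fun r b => if r.2 = b then z ^ (r.1 : ℕ) else 0

theorem canonicalC_mul_powerColumn (h : IsMonicPair p q P Q) (z : ℂ) :
    toC (canonicalC p Q) * powerColumn k p z = evalAt Q z := by
  ext a b
  rw [h.evalAt_num, Matrix.mul_apply, Fintype.sum_prod_type]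
  simp [canonicalC, powerColumn, Matrix.sum_apply, mul_comm]

/-- In every block row but the last, the shift cancels multiplication by `z`; the last row collects
exactly the terms of `P(z)`. -/
theorem canonicalA_mul_powerColumn (h : IsMonicPair p q P Q) (z : ℂ) :
    (z • (1 : Matrix (Fin p × Fin k) (Fin p × Fin k) ℂ) - toC (canonicalA p P)) *
      powerColumn k p z = toC (canonicalB k p) * evalAt P z := by
  ext ⟨i, a⟩ b
  rw [h.evalAt_den, Matrix.sub_mul, Matrix.smul_mul, Matrix.one_mul, Matrix.sub_apply,
    Matrix.mul_apply, Matrix.mul_apply, Fintype.sum_prod_type]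
  by_cases hi : (i : ℕ) + 1 = p
  · have hz : z * z ^ (i : ℕ) = z ^ p := by rw [← pow_succ', hi]
    simp [canonicalA, canonicalB, powerColumn, hi, Matrix.sum_apply, Matrix.one_apply, mul_comm,
      apply_ite Complex.ofReal]
    rw [← hz]
    ring
  · have hi' : (i : ℕ) + 1 < p := by omega
    have : ∀ j : Fin p, ((j : ℕ) = (i : ℕ) + 1) ↔ j = ⟨(i : ℕ) + 1, hi'⟩ := fun j => by
      rw [Fin.ext_iff]
    simp [canonicalA, canonicalB, powerColumn, hi, this, Matrix.one_apply,
      apply_ite Complex.ofReal, pow_succ']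

theorem transfer_canonical (h : IsMonicPair p q P Q) {z : ℂ}
    (hz : z ∉ eigenvalues (canonicalA p P)) (hP : IsUnit (evalAt P z)) :
    transfer (canonicalA p P) (canonicalB k p) (canonicalC p Q) z =
      evalAt Q z * (evalAt P z)⁻¹ := by
  have hB : toC (canonicalB k p) =
      (z • (1 : Matrix (Fin p × Fin k) (Fin p × Fin k) ℂ) - toC (canonicalA p P)) *
        powerColumn k p z * (evalAt P z)⁻¹ := by
    rw [canonicalA_mul_powerColumn h, Matrix.mul_assoc,
      Matrix.mul_nonsing_inv _ ((Matrix.isUnit_iff_isUnit_det _).1 hP), Matrix.mul_one]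
  rw [transfer, hB, Matrix.mul_assoc (toC _), Matrix.mul_assoc _ (powerColumn k p z),
    ← Matrix.mul_assoc _⁻¹, inv_mul_of_not_mem_eigenvalues hz, Matrix.one_mul,
    ← Matrix.mul_assoc, canonicalC_mul_powerColumn h]

theorem vecMul_canonicalB (v : Fin p × Fin k → ℝ) (j : Fin p) (hj : (j : ℕ) + 1 = p) (b : Fin k) :
    Matrix.vecMul v (canonicalB k p) b = v (j, b) := by
  have : ∀ i : Fin p, ((i : ℕ) + 1 = p) ↔ i = j := fun i => by rw [Fin.ext_iff]; omega
  simp [Matrix.vecMul, dotProduct, Fintype.sum_prod_type, canonicalB, this, Matrix.one_apply]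

/-- The hypothesis on `v` kills its last block, so the coefficient row of the companion matrix does
not contribute and only the block shift remains. -/
theorem vecMul_canonicalA (v : Fin p × Fin k → ℝ) (hv : Matrix.vecMul v (canonicalB k p) = 0)
    (i j : Fin p) (hij : (j : ℕ) = i + 1) (b : Fin k) :
    Matrix.vecMul v (canonicalA p P) (j, b) = v (i, b) := by
  have h0 : ∀ (l : Fin p) (a : Fin k), (l : ℕ) + 1 = p → v (l, a) = 0 := fun l a hl => by
    rw [← vecMul_canonicalB v l hl a, hv, Pi.zero_apply]
  rw [Matrix.vecMul, dotProduct, Finset.sum_eq_single (i, b)]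
  · have : (i : ℕ) + 1 ≠ p := by have := j.2; omega
    simp [canonicalA, hij, this]
  · rintro ⟨l, a⟩ - hne
    by_cases hl : (l : ℕ) + 1 = p
    · rw [h0 l a hl, zero_mul]
    · by_cases hjl : (j : ℕ) = l + 1
      · have : l = i := Fin.ext (by omega)
        subst this
        have hab : a ≠ b := fun e => hne (by rw [e])
        simp [canonicalA, hl, hjl, Matrix.one_apply, hab]
      · simp [canonicalA, hl, hjl]
  · simp

theorem isControllable_canonical (P : (Matrix (Fin k) (Fin k) ℝ)[X]) :
    IsControllable (canonicalA p P) (canonicalB k p) := by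
  -- `d` counts the blocks after block `j`. Each multiplication by the companion matrix shifts `v`
  -- one block closer to the end, where the input matrix reads it off.
  have key : ∀ (d : ℕ) (v : Fin p × Fin k → ℝ),
      (∀ i : ℕ, Matrix.vecMul v (canonicalA p P ^ i * canonicalB k p) = 0) →
      ∀ (j : Fin p) (b : Fin k), (j : ℕ) + 1 + d = p → v (j, b) = 0 := by
    intro d
    induction d with
    | zero =>
      intro v hv j b hj
      have := hv 0
      rw [pow_zero, Matrix.one_mul] at this
      rw [← vecMul_canonicalB v j hj b, this, Pi.zero_apply]
    | succ d ih =>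
      intro v hv j b hj
      have h0 := hv 0
      rw [pow_zero, Matrix.one_mul] at h0
      rw [← vecMul_canonicalA (P := P) v h0 j ⟨j + 1, by omega⟩ rfl b]
      refine ih _ (fun i => ?_) _ b (by simp only; omega)
      rw [Matrix.vecMul_vecMul, ← Matrix.mul_assoc, ← pow_succ', hv]
  intro v hv
  funext ⟨j, b⟩
  exact key (p - (j + 1)) v hv j b (by have := j.2; omega)

theorem RightCoprime.eq_zero (h : RightCoprime P Q) {z : ℂ} {u : Fin k → ℂ}
    (hP : Matrix.mulVec (evalAt P z) u = 0) (hQ : Matrix.mulVec (evalAt Q z) u = 0) : u = 0 := by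
  have h1 := h z
  have h2 := LinearMap.finrank_range_add_finrank_ker
    (Matrix.fromRows (evalAt P z) (evalAt Q z)).mulVecLin
  rw [← Matrix.rank, h1, Module.finrank_fin_fun] at h2
  have h3 : LinearMap.ker (Matrix.fromRows (evalAt P z) (evalAt Q z)).mulVecLin = ⊥ :=
    Submodule.finrank_eq_zero.1 (by omega)
  refine (LinearMap.ker_eq_bot'.1 h3) u ?_
  rw [Matrix.mulVecLin_apply, Matrix.fromRows_mulVec, hP, hQ]
  funext x
  cases x <;> rfl

theorem canonicalA_mulVec_of_lt (v : Fin p × Fin k → ℂ) (i : Fin p) (hi : (i : ℕ) + 1 < p)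
    (a : Fin k) :
    Matrix.mulVec (toC (canonicalA p P)) v (i, a) = v (⟨i + 1, hi⟩, a) := by
  have : ∀ j : Fin p, ((j : ℕ) = (i : ℕ) + 1) ↔ j = ⟨(i : ℕ) + 1, hi⟩ := fun j => by
    rw [Fin.ext_iff]
  simp [Matrix.mulVec, dotProduct, Fintype.sum_prod_type, canonicalA, hi.ne, this,
    Matrix.one_apply, apply_ite Complex.ofReal]

/-- Eigenvectors of the block companion matrix have the form `(u, z u, …, z ^ (p - 1) u)`. -/
theorem canonical_eigenvector {z : ℂ} {v : Fin p × Fin k → ℂ}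
    (hv : Matrix.mulVec (toC (canonicalA p P)) v = z • v) (hp : 0 < p) :
    v = Matrix.mulVec (powerColumn k p z) fun a => v (⟨0, hp⟩, a) := by
  have key : ∀ (i : ℕ) (hi : i < p) (a : Fin k), v (⟨i, hi⟩, a) = z ^ i * v (⟨0, hp⟩, a) := by
    intro i
    induction i with
    | zero => simp
    | succ i ih =>
      intro hi a
      rw [← canonicalA_mulVec_of_lt (P := P) v ⟨i, by omega⟩ hi a, hv, Pi.smul_apply, ih,
        smul_eq_mul, pow_succ']
      ring
  funext ⟨i, a⟩
  rw [key i i.2 a]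
  simp [powerColumn, Matrix.mulVec, dotProduct]

theorem canonicalB_mulVec_eq_zero (hp : 0 < p) {w : Fin k → ℂ}
    (h : Matrix.mulVec (toC (canonicalB k p)) w = 0) : w = 0 := by
  funext a
  have := congrFun h (⟨p - 1, by omega⟩, a)
  have hp' : p - 1 + 1 = p := by omega
  simpa [Matrix.mulVec, dotProduct, canonicalB, hp', Matrix.one_apply,
    apply_ite Complex.ofReal] using this

/-- The complex unobservable subspace is invariant, so if nonzero it contains an eigenvector `(u, z
u, …, z ^ (p - 1) u)`. The eigenvalue equation gives `P(z) u = 0` and unobservability gives `Q(z) u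
= 0`, contradicting coprimeness. -/
theorem isObservable_canonical (h : IsMonicPair p q P Q) (hc : RightCoprime P Q) :
    IsObservable (canonicalA p P) (canonicalC p Q) := by
  have hp : 0 < p := (Nat.zero_le q).trans_lt h.lt
  set A := toC (canonicalA p P) with hA
  set C := toC (canonicalC p Q) with hC
  let N : Submodule ℂ (Fin p × Fin k → ℂ) := ⨅ i : ℕ, LinearMap.ker (C * A ^ i).mulVecLin
  have hmem : ∀ v, v ∈ N ↔ ∀ i : ℕ, Matrix.mulVec (C * A ^ i) v = 0 := by
    intro v
    simp [N, Submodule.mem_iInf]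
  have hinv : ∀ v ∈ N, A.mulVecLin v ∈ N := by
    intro v hv
    rw [hmem] at hv ⊢
    intro i
    rw [Matrix.mulVecLin_apply, Matrix.mulVec_mulVec, Matrix.mul_assoc, ← pow_succ, hv]
  have hN : N = ⊥ := by
    by_contra hne
    have : Nontrivial N := Submodule.nontrivial_iff_ne_bot.2 hne
    obtain ⟨z, hz⟩ := Module.End.exists_eigenvalue (A.mulVecLin.restrict hinv)
    obtain ⟨⟨v, hvN⟩, hv⟩ := hz.exists_hasEigenvector
    have hv0 : v ≠ 0 := fun e => hv.2 (Subtype.ext e)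
    have hAv : Matrix.mulVec A v = z • v := congrArg Subtype.val hv.apply_eq_smul
    have hCv : Matrix.mulVec C v = 0 := by simpa using (hmem v).1 hvN 0
    have hV := canonical_eigenvector hAv hp
    set u : Fin k → ℂ := fun a => v (⟨0, hp⟩, a)
    have hu : u = 0 := by
      refine hc.eq_zero (z := z) (canonicalB_mulVec_eq_zero hp ?_) ?_
      · rw [Matrix.mulVec_mulVec, ← canonicalA_mul_powerColumn h, ← Matrix.mulVec_mulVec, ← hV,
          Matrix.sub_mulVec, hAv, Matrix.smul_mulVec, Matrix.one_mulVec, sub_self]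
      · rw [← canonicalC_mul_powerColumn h, ← Matrix.mulVec_mulVec, ← hV, hCv]
    exact hv0 (by rw [hV, hu, Matrix.mulVec_zero])
  intro v hv
  have : (fun s => (v s : ℂ)) ∈ N := by
    rw [hmem]
    intro i
    rw [hA, hC, ← toC_pow, ← toC_mul]
    funext a
    have := congrArg (fun x : ℝ => (x : ℂ)) (congrFun (hv i) a)
    simpa [Matrix.mulVec, dotProduct] using this
  rw [hN, Submodule.mem_bot] at this
  funext s
  exact Complex.ofReal_eq_zero.1 (congrFun this s)

end Canonical

/-! ### Rigidity of the canonical form -/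

section Uniqueness

variable {k p q q₁ : ℕ} {P Q P₁ Q₁ : (Matrix (Fin k) (Fin k) ℝ)[X]}

theorem canonicalA_mul_apply_of_lt {l : Type*} (M : Matrix (Fin p × Fin k) l ℝ) (i : Fin p)
    (hi : (i : ℕ) + 1 < p) (a : Fin k) (r : l) :
    (canonicalA p P * M) (i, a) r = M (⟨i + 1, hi⟩, a) r := by
  have : ∀ j : Fin p, ((j : ℕ) = (i : ℕ) + 1) ↔ j = ⟨(i : ℕ) + 1, hi⟩ := fun j => by
    rw [Fin.ext_iff]
  simp [Matrix.mul_apply, Fintype.sum_prod_type, canonicalA, hi.ne, this, Matrix.one_apply]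

theorem vecMul_canonicalA_zero (v : Fin p × Fin k → ℝ)
    (hv : Matrix.vecMul v (canonicalB k p) = 0) (hp : 0 < p) (b : Fin k) :
    Matrix.vecMul v (canonicalA p P) (⟨0, hp⟩, b) = 0 := by
  refine Finset.sum_eq_zero fun ⟨l, a⟩ _ => ?_
  by_cases hl : (l : ℕ) + 1 = p
  · rw [← vecMul_canonicalB v l hl a, hv, Pi.zero_apply, zero_mul]
  · simp [canonicalA, hl]

/-- A state space transformation between two canonical triples is the identity. -/
theorem canonical_similarity_eq_one {T S : Matrix (Fin p × Fin k) (Fin p × Fin k) ℝ}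
    (h : IsSimilarity (canonicalA p P₁) (canonicalB k p) (canonicalC p Q₁)
      (canonicalA p P) (canonicalB k p) (canonicalC p Q) T S) : T = 1 := by
  have hB : ∀ i a, Matrix.vecMul (T (i, a)) (canonicalB k p) = canonicalB k p (i, a) :=
    fun i a => congrFun h.map_B (i, a)
  have hB0 : ∀ (i : Fin p) a, (i : ℕ) + 1 < p →
      Matrix.vecMul (T (i, a)) (canonicalB k p) = 0 := fun i a hi => by
    rw [hB]
    funext b
    simp [canonicalB, hi.ne]
  have hA : ∀ (i : Fin p) (hi : (i : ℕ) + 1 < p) a r,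
      T (⟨i + 1, hi⟩, a) r = Matrix.vecMul (T (i, a)) (canonicalA p P₁) r := fun i hi a r => by
    exact (canonicalA_mul_apply_of_lt (P := P) T i hi a r).symm.trans (by rw [← h.map_A]; rfl)
  -- `T` is block Toeplitz: block row `i + 1` is block row `i` times the companion matrix, and that
  -- product is a pure shift because block row `i` ends in a zero block.
  have hdiag : ∀ (i j : Fin p) (hi : (i : ℕ) + 1 < p) (hj : (j : ℕ) + 1 < p) a b,
      T (⟨i + 1, hi⟩, a) (⟨j + 1, hj⟩, b) = T (i, a) (j, b) := fun i j hi hj a b => by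
    rw [hA, vecMul_canonicalA _ (hB0 i a hi) j _ rfl]
  -- On and above the diagonal, follow the block diagonal down to the last block column, which `T *
  -- B = B` determines.
  have hupper : ∀ (d : ℕ) (i j : Fin p) (a b : Fin k), (j : ℕ) + 1 + d = p → i ≤ j →
      T (i, a) (j, b) = (1 : Matrix (Fin p × Fin k) (Fin p × Fin k) ℝ) (i, a) (j, b) := by
    intro d
    induction d with
    | zero =>
      intro i j a b hj _
      rw [← vecMul_canonicalB (T (i, a)) j hj b, hB]
      have : ((i : ℕ) + 1 = p) ↔ i = j := by rw [Fin.ext_iff]; omega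
      simp [canonicalB, this, Matrix.one_apply, ite_and]
    | succ d ih =>
      intro i j a b hj hij
      have hij' : (i : ℕ) ≤ j := hij
      rw [← hdiag i j (by omega) (by omega), ih _ _ a b (by simp only; omega) (by simpa using hij)]
      simp [Matrix.one_apply, Fin.ext_iff]
  -- Below the diagonal, follow the block diagonal up to block column `0`, where the shift brings in
  -- zeros.
  have hlower : ∀ (j i : ℕ) (hj : j < p) (hi : i < p) (a b : Fin k), j < i →
      T (⟨i, hi⟩, a) (⟨j, hj⟩, b) = 0 := by
    intro j
    induction j with
    | zero =>
      rintro (_ | i) hj hi a b hij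
      · omega
      · rw [hA ⟨i, by omega⟩ hi, vecMul_canonicalA_zero _ (hB0 ⟨i, by omega⟩ a hi)]
    | succ j ih =>
      rintro (_ | i) hj hi a b hij
      · omega
      · rw [hdiag ⟨i, by omega⟩ ⟨j, by omega⟩ hi hj]
        exact ih _ _ _ _ _ (by omega)
  ext ⟨i, a⟩ ⟨j, b⟩
  rcases le_or_gt i j with hij | hij
  · exact hupper (p - (j + 1)) i j a b (by have := j.2; omega) hij
  · rw [hlower j i j.2 i.2 a b hij, Matrix.one_apply_ne]
    exact fun e => hij.ne' (congrArg Prod.fst e)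

theorem IsMonicPair.eq_of_canonical_eq (h : IsMonicPair p q P Q) (h₁ : IsMonicPair p q₁ P₁ Q₁)
    (hA : canonicalA p P₁ = canonicalA p P) (hC : canonicalC p Q₁ = canonicalC p Q) :
    P₁ = P ∧ Q₁ = Q := by
  have hp : p - 1 + 1 = p := Nat.sub_add_cancel ((Nat.zero_le q).trans_lt h.lt)
  constructor
  · ext i a b
    rcases lt_trichotomy i p with hi | rfl | hi
    · have := congrFun (congrFun hA (⟨p - 1, by omega⟩, a)) (⟨i, hi⟩, b)
      simpa [canonicalA, hp] using this
    · rw [h.coeff_lead, h₁.coeff_lead]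
    · rw [h.coeff_above i hi, h₁.coeff_above i hi]
  · ext i a b
    by_cases hi : i < p
    · exact congrFun (congrFun hC a) (⟨i, hi⟩, b)
    · rw [h.coeff_num i (h.lt.trans_le (not_lt.1 hi)), h₁.coeff_num i (h₁.lt.trans_le (not_lt.1 hi))]

end Uniqueness

/-! ### Transport of solutions along a similarity -/

section Stochastic

variable {Ω : Type*} [MeasurableSpace Ω] {μ : Measure Ω}
  {n m : Type*} [Fintype n] [DecidableEq n] [Fintype m] [DecidableEq m] {k : ℕ}
  {L : ℝ → Ω → Fin k → ℝ}
  {A' : Matrix m m ℝ} {B' : Matrix m (Fin k) ℝ} {C' : Matrix (Fin k) m ℝ}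
  {A : Matrix n n ℝ} {B : Matrix n (Fin k) ℝ} {C : Matrix (Fin k) n ℝ}
  {T : Matrix n m ℝ} {S : Matrix m n ℝ}

theorem tendstoInMeasure_clm_comp {E F ι : Type*} [NormedAddCommGroup E] [NormedSpace ℝ E]
    [NormedAddCommGroup F] [NormedSpace ℝ F] (φ : E →L[ℝ] F) {l : Filter ι} {f : ι → Ω → E}
    {g : Ω → E} (h : TendstoInMeasure μ f l g) :
    TendstoInMeasure μ (fun i ω => φ (f i ω)) l (fun ω => φ (g ω)) := by
  rw [tendstoInMeasure_iff_norm] at h ⊢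
  intro ε hε
  -- The added `1` keeps the divisor positive when `φ = 0`.
  have hK : 0 < ‖φ‖ + 1 := by positivity
  refine tendsto_of_tendsto_of_tendsto_of_le_of_le tendsto_const_nhds (h (ε / (‖φ‖ + 1))
    (by positivity)) (fun _ => zero_le) fun i => measure_mono fun ω hω => ?_
  simp only [Set.mem_ofPred_eq, ← map_sub] at hω ⊢
  rw [div_le_iff₀ hK]
  calc ε ≤ ‖φ (f i ω - g ω)‖ := hω
    _ ≤ ‖φ‖ * ‖f i ω - g ω‖ := φ.le_opNorm _
    _ ≤ ‖f i ω - g ω‖ * (‖φ‖ + 1) := by nlinarith [norm_nonneg (f i ω - g ω)]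

theorem measurable_mulVec_comp {a b : Type*} [Fintype a] [Fintype b] (M : Matrix b a ℝ)
    {f : Ω → a → ℝ} (hf : Measurable f) :
    Measurable fun ω => Matrix.mulVec M (f ω) :=
  (LinearMap.toContinuousLinearMap M.mulVecLin).continuous.measurable.comp hf

theorem intervalIntegrable_mulVec_comp {a b : Type*} [Fintype a] [Fintype b] (M : Matrix b a ℝ)
    {f : ℝ → a → ℝ} {s t : ℝ} (hf : IntervalIntegrable f volume s t) :
    IntervalIntegrable (fun u => Matrix.mulVec M (f u)) volume s t :=
  let φ := LinearMap.toContinuousLinearMap M.mulVecLin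
  ⟨φ.integrable_comp hf.1, φ.integrable_comp hf.2⟩

theorem SolvesStateEquation.map (h : IsSimilarity A' B' C' A B C T S) {X : ℝ → Ω → m → ℝ}
    (hX : SolvesStateEquation μ L A' B' X) :
    SolvesStateEquation μ L A B fun t ω => Matrix.mulVec T (X t ω) := by
  refine ⟨fun t => measurable_mulVec_comp T (hX.1 t), fun s t hst => ?_⟩
  filter_upwards [hX.2 s t hst] with ω hω
  obtain ⟨hi, he⟩ := hω
  refine ⟨intervalIntegrable_mulVec_comp T hi, ?_⟩
  have hA : ∀ u, Matrix.mulVec A (Matrix.mulVec T (X u ω)) =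
      LinearMap.toContinuousLinearMap T.mulVecLin (Matrix.mulVec A' (X u ω)) := fun u => by
    simp [Matrix.mulVec_mulVec, h.map_A]
  simp_rw [hA]
  rw [ContinuousLinearMap.intervalIntegral_comp_comm _ (intervalIntegrable_mulVec_comp A' hi), ← Matrix.mulVec_sub, he,
    Matrix.mulVec_add, Matrix.mulVec_mulVec, h.map_B]
  rfl

theorem IsSimilarity.exp_smul (h : IsSimilarity A' B' C' A B C T S) (r : ℝ) :
    T * NormedSpace.exp (r • A') = NormedSpace.exp (r • A) * T := by
  -- Conjugation is a linear equivalence in finite dimension, hence a homeomorphism, so it passes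
  -- through the exponential series without a separate summability argument.
  let e : Matrix m m ℝ ≃ₗ[ℝ] Matrix n n ℝ :=
    { toFun := fun M => T * M * S
      invFun := fun M => S * M * T
      map_add' := fun M N => by rw [Matrix.mul_add, Matrix.add_mul]
      map_smul' := fun c M => by simp
      left_inv := fun M => by
        calc S * (T * M * S) * T = (S * T) * M * (S * T) := by simp only [Matrix.mul_assoc]
          _ = M := by rw [h.inv_mul, Matrix.one_mul, Matrix.mul_one]
      right_inv := fun M => by
        calc T * (S * M * T) * S = (T * S) * M * (T * S) := by simp only [Matrix.mul_assoc]
          _ = M := by rw [h.mul_inv, Matrix.one_mul, Matrix.mul_one] }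
  have hA : T * (r • A') = r • A * T := by
    rw [Matrix.mul_smul, h.map_A, Matrix.smul_mul]
  have hcomm : ∀ i : ℕ, T * (r • A') ^ i = (r • A) ^ i * T := by
    intro i
    induction i with
    | zero => simp
    | succ i ih =>
      rw [pow_succ, ← Matrix.mul_assoc, ih, Matrix.mul_assoc, hA, ← Matrix.mul_assoc, ← pow_succ]
  have hpow : ∀ i : ℕ, e ((r • A') ^ i) = (r • A) ^ i := by
    intro i
    change T * (r • A') ^ i * S = (r • A) ^ i
    rw [hcomm, Matrix.mul_assoc, h.mul_inv, Matrix.mul_one]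
  have he : T * NormedSpace.exp (r • A') * S = NormedSpace.exp (r • A) := by
    change e _ = _
    rw [NormedSpace.exp_eq_tsum ℝ, NormedSpace.exp_eq_tsum ℝ]
    refine (e.toContinuousLinearEquiv.map_tsum (L := .unconditional ℕ)).trans
      (tsum_congr fun i => ?_)
    rw [map_smul]
    exact congrArg _ (hpow i)
  rw [← he, Matrix.mul_assoc _ S, h.inv_mul, Matrix.mul_one]

/-- Applying `T` turns each Riemann–Stieltjes sum for the primed triple into the one for the
unprimed triple, and a continuous linear map preserves limits in probability. -/
theorem SatisfiesSolutionFormula.map (h : IsSimilarity A' B' C' A B C T S) {X : ℝ → Ω → m → ℝ}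
    (hX : SatisfiesSolutionFormula μ L A' B' X) :
    SatisfiesSolutionFormula μ L A B fun t ω => Matrix.mulVec T (X t ω) := by
  refine ⟨fun t => measurable_mulVec_comp T (hX.1 t), fun s t hst N u hmono h0 hN hmesh => ?_⟩
  have := tendstoInMeasure_clm_comp (LinearMap.toContinuousLinearMap T.mulVecLin)
    (hX.2 s t hst N u hmono h0 hN hmesh)
  have hB : ∀ r : ℝ, T * (NormedSpace.exp (r • A') * B') = NormedSpace.exp (r • A) * B :=
    fun r => by rw [← Matrix.mul_assoc, h.exp_smul, Matrix.mul_assoc, h.map_B]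
  simpa only [LinearMap.coe_toContinuousLinearMap', map_sum, map_sub, Matrix.mulVecLin_apply,
    Matrix.mulVec_mulVec, hB, h.exp_smul] using this

theorem IsSolution.map (h : IsSimilarity A' B' C' A B C T S) {Y : ℝ → Ω → Fin k → ℝ}
    (hY : IsSolution μ L A' B' C' Y) : IsSolution μ L A B C Y := by
  obtain ⟨X, hX, hXY⟩ := hY
  refine ⟨_, hX.map h, fun t => ?_⟩
  filter_upwards [hXY t] with ω hω
  rw [hω, Matrix.mulVec_mulVec, h.map_C]

theorem IsMildSolution.map (h : IsSimilarity A' B' C' A B C T S) {Y : ℝ → Ω → Fin k → ℝ}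
    (hY : IsMildSolution μ L A' B' C' Y) : IsMildSolution μ L A B C Y := by
  obtain ⟨X, hX, hXY⟩ := hY
  refine ⟨_, hX.map h, fun t => ?_⟩
  filter_upwards [hXY t] with ω hω
  rw [hω, Matrix.mulVec_mulVec, h.map_C]

end Stochastic

/-! ### Uniqueness of the coprime fraction -/

section Fraction

variable {n : Type*} [Fintype n] [DecidableEq n] {k p q p₁ q₁ : ℕ}
  {A' : Matrix n n ℝ} {B' : Matrix n (Fin k) ℝ} {C' : Matrix (Fin k) n ℝ}
  {P Q P₁ Q₁ : (Matrix (Fin k) (Fin k) ℝ)[X]}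

theorem IsCoprimeRightFraction.markov_eq (h : IsMonicPair p q P Q)
    (hH : IsCoprimeRightFraction A' B' C' P Q) (i : ℕ) :
    C' * A' ^ i * B' = canonicalC p Q * canonicalA p P ^ i * canonicalB k p := by
  refine markov_eq_of_transfer_eq ?_ i
  filter_upwards [eventually_not_mem_eigenvalues A',
    eventually_not_mem_eigenvalues (canonicalA p P)] with z hz hz'
  rw [(hH.2 z hz).2, transfer_canonical h hz' (hH.2 z hz).1]

theorem IsCoprimeRightFraction.unique (h : IsMonicPair p q P Q)
    (hH : IsCoprimeRightFraction A' B' C' P Q) (h₁ : IsMonicPair p₁ q₁ P₁ Q₁)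
    (hH₁ : IsCoprimeRightFraction A' B' C' P₁ Q₁) : P₁ = P ∧ Q₁ = Q := by
  -- For `k = 0` the state dimension does not determine the degree, but all matrix polynomials
  -- coincide.
  rcases Nat.eq_zero_or_pos k with rfl | hk
  · exact ⟨Subsingleton.elim _ _, Subsingleton.elim _ _⟩
  have hM : ∀ i, canonicalC p₁ Q₁ * canonicalA p₁ P₁ ^ i * canonicalB k p₁ =
      canonicalC p Q * canonicalA p P ^ i * canonicalB k p := fun i =>
    (hH₁.markov_eq h₁ i).symm.trans (hH.markov_eq h i)
  -- Both canonical triples are minimal, so `k p₁ = k p`.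
  have hle := card_le_of_markov (isControllable_canonical P) (isObservable_canonical h hH.1) hM
  have hge := card_le_of_markov (isControllable_canonical P₁) (isObservable_canonical h₁ hH₁.1)
    fun i => (hM i).symm
  have hp : p₁ = p := by
    have := le_antisymm hge hle
    simp only [Fintype.card_prod, Fintype.card_fin] at this
    exact Nat.eq_of_mul_eq_mul_right hk this
  subst hp
  obtain ⟨T, S, hTS⟩ := exists_similarity (isControllable_canonical P)
    (isObservable_canonical h hH.1) hM rfl
  obtain rfl := canonical_similarity_eq_one hTS
  refine h.eq_of_canonical_eq h₁ ?_ ?_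
  · simpa using hTS.map_A
  · simpa using hTS.map_C.symm

end Fraction

end StateSpace

theorem mainTheorem11 {Ω : Type*} [MeasurableSpace Ω] (μ : Measure Ω) [IsProbabilityMeasure μ]
    (k p q : ℕ)
    (A' : Matrix (Fin (k * p)) (Fin (k * p)) ℝ) (B' : Matrix (Fin (k * p)) (Fin k) ℝ)
    (C' : Matrix (Fin k) (Fin (k * p)) ℝ)
    (L : ℝ → Ω → Fin k → ℝ) (hL : StateSpace.IsLevyProcess μ L)
    (P Q : (Matrix (Fin k) (Fin k) ℝ)[X]) (hPQ : StateSpace.IsMonicPair p q P Q)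
    (hH : StateSpace.IsCoprimeRightFraction A' B' C' P Q) :
    (∀ (p₁ q₁ : ℕ) (P₁ Q₁ : (Matrix (Fin k) (Fin k) ℝ)[X]),
        StateSpace.IsMonicPair p₁ q₁ P₁ Q₁ →
        StateSpace.IsCoprimeRightFraction A' B' C' P₁ Q₁ → P₁ = P ∧ Q₁ = Q) ∧
    StateSpace.eigenvalues A' = StateSpace.eigenvalues (StateSpace.canonicalA p P) ∧
    (∀ z : ℂ, z ∉ StateSpace.eigenvalues (StateSpace.canonicalA p P) →
        StateSpace.transfer A' B' C' z =
          StateSpace.transfer (StateSpace.canonicalA p P) (StateSpace.canonicalB k p)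
            (StateSpace.canonicalC p Q) z) ∧
    (∀ Y : ℝ → Ω → Fin k → ℝ,
        StateSpace.IsSolution μ L A' B' C' Y ↔
          StateSpace.IsSolution μ L (StateSpace.canonicalA p P) (StateSpace.canonicalB k p)
            (StateSpace.canonicalC p Q) Y) ∧
    (∀ Y : ℝ → Ω → Fin k → ℝ,
        StateSpace.IsMildSolution μ L A' B' C' Y ↔
          StateSpace.IsMildSolution μ L (StateSpace.canonicalA p P) (StateSpace.canonicalB k p)
            (StateSpace.canonicalC p Q) Y) := by
  obtain ⟨T, S, h⟩ := StateSpace.exists_similarity (StateSpace.isControllable_canonical P)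
    (StateSpace.isObservable_canonical hPQ hH.1) (hH.markov_eq hPQ) (by simp [mul_comm])
  exact ⟨fun _ _ _ _ h₁ hH₁ => hH.unique hPQ h₁ hH₁, h.eigenvalues_eq,
    fun _ hz => h.transfer_eq hz, fun _ => ⟨fun hY => hY.map h, fun hY => hY.map h.symm⟩,
    fun _ => ⟨fun hY => hY.map h, fun hY => hY.map h.symm⟩⟩
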